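/- Let $A\in\mathbb R^{n\times n}$, $B\in\mathbb R^{n\times m}$, $S\in\mathbb R^{m\times n}$ and let $Q\in\mathbb R^{n\times n}$, $R\in\mathbb R^{m\times m}$ be symmetric (no definiteness is assumed). Put $H=\begin{pmatrix}Q&S^\top\\S&R\end{pmatrix}$ and $\ell(x,u)=\begin{pmatrix}x\\u\end{pmatrix}^{\!\top}H\begin{pmatrix}x\\u\end{pmatrix}$. For a symmetric matrix $P^{\mathrm f}\in\mathbb R^{n\times n}$ and $x_0\in\mathbb R^n$ consider the infinite-horizon LQR problem $$V(x_0)=\min_{u_0,u_1,\ldots}\ \lim_{N\to\infty}\Big(\sum_{k=0}^{N-1}\ell(x_k,u_k)+x_N^\top P^{\mathrm f}x_N\Big)\quad\text{s.t.}\quad x_{k+1}=Ax_k+Bu_k,$$ where the minimum is over all input sequences for which the limit exists in $[-\infty,\infty]$. A solution of the corresponding discrete algebraic Riccati equation (DARE) is a symmetric matrix $P$ such that $R+B^\top PB$ is invertible and $$P=Q+A^\top PA-(S^\top+A^\top PB)K_P,\qquad K_P=(R+B^\top PB)^{-1}(S+B^\top PA).$$ It is called stabilizing (antistabilizing) if every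 complex eigenvalue $\mu$ of $A-BK_P$ satisfies $|\mu|<1$ ($|\mu|>1$). Assume that $(A,B)$ is stabilizable, i.e. all eigenvalues of $A-BK$ lie in the open unit disc for some $K\in\mathbb R^{m\times n}$; that the problem is strictly $(x,u)$-pre-dissipative, i.e. there is a symmetric $\Lambda\in\mathbb R^{n\times n}$ with $$\begin{pmatrix}Q+\Lambda-A^\top\Lambda A& S^\top-A^\top\Lambda B\\ S-B^\top\Lambda A&R-B^\top\Lambda B\end{pmatrix}\succ0;$$ and that the DARE has an antistabilizing solution $P_{\mathrm a}$. Theorem. For every symmetric $E\succ0$, the infinite-horizon problem with terminal cost matrix $P^{\mathrm f}=P_{\mathrm a}+E$ is solved by the stabilizing solution of the DARE. That is, the DARE has exactly one stabilizing solution $P_{\mathrm s}$, and, with $K_{\mathrm s}=K_{P_{\mathrm s}}$, for every $x_0\in\mathbb R^n$: 1. the minimum is attained and $V(x_0)=x_0^\top P_{\mathrm s}x_0$; 2. an input sequence $u$ with trajectory $x$ is optimal if and only if $u_k=-K_{\mathrm s}x_k$ for all $k\ge0$; 3. for every input sequence (also if the limit does not exist), $\liminf_{N\to\infty}\big(\sum_{k=0}^{N-1}\ell(x_k,u_k)+x_N^\top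 P^{\mathrm f}x_N\big)\ge x_0^\top P_{\mathrm s}x_0$. In particular, the origin is an asymptotically stable equilibrium of the optimally controlled system $x_{k+1}=(A-BK_{\mathrm s})x_k$. -/

import Mathlib

open Matrix Filter Topology

noncomputable section

/-- Data of a linear-quadratic problem with state space `ℝⁿ` and input space `ℝᵐ`:
dynamics `x⁺ = A x + B u`, and the blocks `Q`, `S`, `R` of the symmetric stage cost matrix
`[[Q, Sᵀ], [S, R]]`. No definiteness is required. -/
structure LQProblem (n m : ℕ) where
  A : Matrix (Fin n) (Fin n) ℝ
  B : Matrix (Fin n) (Fin m) ℝ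
  Q : Matrix (Fin n) (Fin n) ℝ
  S : Matrix (Fin m) (Fin n) ℝ
  R : Matrix (Fin m) (Fin m) ℝ
  Q_symm : Q.IsSymm
  R_symm : R.IsSymm

/-- All complex eigenvalues of the real matrix `M` satisfy `|μ| < 1`. -/
def IsSchurStable {n : ℕ} (M : Matrix (Fin n) (Fin n) ℝ) : Prop :=
  ∀ μ ∈ spectrum ℂ (M.map (algebraMap ℝ ℂ)), ‖μ‖ < 1

/-- All complex eigenvalues of the real matrix `M` satisfy `|μ| > 1`. -/
def IsAntistable {n : ℕ} (M : Matrix (Fin n) (Fin n) ℝ) : Prop :=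
  ∀ μ ∈ spectrum ℂ (M.map (algebraMap ℝ ℂ)), 1 < ‖μ‖

/-- `x₀` is an asymptotically stable equilibrium of `x_{k+1} = f (x_k)`: it is a fixed point,
it is Lyapunov stable, and it attracts all trajectories starting close to it. -/
def IsAsymptoticallyStableEquilibrium {X : Type*} [TopologicalSpace X] (f : X → X) (x₀ : X) :
    Prop :=
  f x₀ = x₀ ∧
  (∀ U ∈ 𝓝 x₀, ∃ V ∈ 𝓝 x₀, ∀ x ∈ V, ∀ k : ℕ, f^[k] x ∈ U) ∧
  (∀ᶠ x in 𝓝 x₀, Tendsto (fun k : ℕ => f^[k] x) atTop (𝓝 x₀))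

namespace LQProblem

variable {n m : ℕ} (p : LQProblem n m)

/-- The stage cost matrix `H`. -/
def H : Matrix (Fin n ⊕ Fin m) (Fin n ⊕ Fin m) ℝ :=
  fromBlocks p.Q p.Sᵀ p.S p.R

/-- The stage cost `ℓ(x,u) = [x; u]ᵀ H [x; u]`. -/
def stageCost (x : Fin n → ℝ) (u : Fin m → ℝ) : ℝ :=
  Sum.elim x u ⬝ᵥ (p.H *ᵥ Sum.elim x u)

/-- The rotated stage cost matrix `H_Λ`. -/
def rotatedH (L : Matrix (Fin n) (Fin n) ℝ) : Matrix (Fin n ⊕ Fin m) (Fin n ⊕ Fin m) ℝ :=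
  fromBlocks (p.Q + L - p.Aᵀ * L * p.A) (p.Sᵀ - p.Aᵀ * L * p.B)
    (p.S - p.Bᵀ * L * p.A) (p.R - p.Bᵀ * L * p.B)

/-- (Quadratic) strict `(x,u)`-pre-dissipativity: for some quadratic storage function
`λ(x) = xᵀ Λ x`, not necessarily bounded from below, the rotated stage cost is positive
definite. -/
def IsStrictlyPreDissipative : Prop :=
  ∃ L : Matrix (Fin n) (Fin n) ℝ, L.IsSymm ∧ (p.rotatedH L).PosDef

/-- The pair `(A, B)` is stabilizable. -/
def IsStabilizable : Prop :=
  ∃ K : Matrix (Fin m) (Fin n) ℝ, IsSchurStable (p.A - p.B * K)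

/-- The feedback matrix `K = (R + Bᵀ P B)⁻¹ (S + Bᵀ P A)` associated with `P`. -/
def gain (P : Matrix (Fin n) (Fin n) ℝ) : Matrix (Fin m) (Fin n) ℝ :=
  (p.R + p.Bᵀ * P * p.B)⁻¹ * (p.S + p.Bᵀ * P * p.A)

/-- `P` is a (symmetric) solution of the discrete algebraic Riccati equation; the inverse that
occurs in the equation has to exist. -/
structure IsDARESolution (P : Matrix (Fin n) (Fin n) ℝ) : Prop where
  symm : P.IsSymm
  isUnit : IsUnit (p.R + p.Bᵀ * P * p.B)
  eq : P = p.Q + p.Aᵀ * P * p.A - (p.Sᵀ + p.Aᵀ * P * p.B) * p.gain P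

/-- `P` is a stabilizing solution of the DARE. -/
def IsStabilizingSolution (P : Matrix (Fin n) (Fin n) ℝ) : Prop :=
  p.IsDARESolution P ∧ IsSchurStable (p.A - p.B * p.gain P)

/-- `P` is an antistabilizing solution of the DARE. -/
def IsAntistabilizingSolution (P : Matrix (Fin n) (Fin n) ℝ) : Prop :=
  p.IsDARESolution P ∧ IsAntistable (p.A - p.B * p.gain P)

/-- The state trajectory `x_{k+1} = A x_k + B u_k` with initial value `x₀`. -/
def state (x₀ : Fin n → ℝ) (u : ℕ → Fin m → ℝ) : ℕ → Fin n → ℝ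
  | 0 => x₀
  | k + 1 => p.A *ᵥ state x₀ u k + p.B *ᵥ u k

/-- The cost over the horizon `N` with terminal cost matrix `Pf`:
`∑_{k<N} ℓ(x_k, u_k) + x_Nᵀ Pf x_N`. -/
def horizonCost (Pf : Matrix (Fin n) (Fin n) ℝ) (x₀ : Fin n → ℝ) (u : ℕ → Fin m → ℝ)
    (N : ℕ) : ℝ :=
  ∑ k ∈ Finset.range N, p.stageCost (p.state x₀ u k) (u k)
    + p.state x₀ u N ⬝ᵥ (Pf *ᵥ p.state x₀ u N)

/-- The infinite-horizon cost of the input sequence `u`, i.e. the limit of the costs over the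
horizons `N → ∞`, exists in `[-∞, ∞]` and equals `c`. -/
def HasCost (Pf : Matrix (Fin n) (Fin n) ℝ) (x₀ : Fin n → ℝ) (u : ℕ → Fin m → ℝ)
    (c : EReal) : Prop :=
  Tendsto (fun N : ℕ => (p.horizonCost Pf x₀ u N : EReal)) atTop (𝓝 c)

/-- `c` is the optimal value of the infinite-horizon problem with initial value `x₀`
(in particular, the minimum is attained). -/
def IsOptimalValue (Pf : Matrix (Fin n) (Fin n) ℝ) (x₀ : Fin n → ℝ) (c : EReal) : Prop :=
  IsLeast {c' : EReal | ∃ u : ℕ → Fin m → ℝ, p.HasCost Pf x₀ u c'} c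

/-- The input sequence `u` is optimal for the infinite-horizon problem with initial value `x₀`. -/
def IsOptimalInput (Pf : Matrix (Fin n) (Fin n) ℝ) (x₀ : Fin n → ℝ) (u : ℕ → Fin m → ℝ) :
    Prop :=
  ∃ c : EReal, p.HasCost Pf x₀ u c ∧ p.IsOptimalValue Pf x₀ c

end LQProblem

end

/-!
Completing the square in the Bellman equation of a DARE solution `P` writes the finite-horizon cost
with terminal cost matrix `P` as `x₀ᵀ P x₀ + ∑ (u_k + K x_k)ᵀ W (u_k + K x_k)`, where
`W = R + Bᵀ P B`. Another terminal cost matrix changes this only by a quadratic form of the final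
state. Hence, once `W ≻ 0` and every input that avoids the cost `+∞` drives the state to the origin,
the stabilizing solution gives the optimal value and its feedback the only optimal inputs.

Both facts are checked after rotating the problem by the storage function, which makes `H ≻ 0` and
shifts all DARE solutions by `Λ`. Value iteration starting at `0` then increases to a stabilizing
solution, bounded by the cost of any stabilizing feedback; since DARE solutions decrease strictly
along their closed loops, stabilizing solutions are positive definite and antistabilizing ones are
negative definite. If the cost with terminal cost matrix `P_a + E` is at most `b` at horizon `N`,
then `E(x_N) ≤ b - P_a(x₀)` because `W_a ≻ 0`. So `-P_a(x_N)` is bounded, and with it the sum of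
the positive definite stage costs, which forces `x_k → 0`.
-/

noncomputable section

section QuadForm

variable {ι κ : Type*} [Fintype ι] [Fintype κ]

/-- The value `xᵀ P x` of the quadratic form with matrix `P`. -/
def quadForm (P : Matrix ι ι ℝ) (x : ι → ℝ) : ℝ := x ⬝ᵥ (P *ᵥ x)

variable {P : Matrix ι ι ℝ}

lemma quadForm_add_left (P P' : Matrix ι ι ℝ) (x : ι → ℝ) :
    quadForm (P + P') x = quadForm P x + quadForm P' x := by
  simp only [quadForm, add_mulVec, dotProduct_add]

lemma quadForm_neg_left (P : Matrix ι ι ℝ) (x : ι → ℝ) : quadForm (-P) x = -quadForm P x := by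
  simp only [quadForm, neg_mulVec, dotProduct_neg]

@[simp]
lemma quadForm_zero_left (x : ι → ℝ) : quadForm (0 : Matrix ι ι ℝ) x = 0 := by
  simp only [quadForm, zero_mulVec, dotProduct_zero]

@[simp]
lemma quadForm_zero (P : Matrix ι ι ℝ) : quadForm P 0 = 0 := zero_dotProduct _

lemma quadForm_smul (P : Matrix ι ι ℝ) (c : ℝ) (x : ι → ℝ) :
    quadForm P (c • x) = c ^ 2 * quadForm P x := by
  simp only [quadForm, mulVec_smul, smul_dotProduct, dotProduct_smul, smul_eq_mul]
  ring

lemma quadForm_add (P : Matrix ι ι ℝ) (x y : ι → ℝ) :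
    quadForm P (x + y)
      = quadForm P x + quadForm P y + (x ⬝ᵥ (P *ᵥ y) + y ⬝ᵥ (P *ᵥ x)) := by
  simp only [quadForm, mulVec_add, dotProduct_add, add_dotProduct]
  ring

lemma quadForm_mulVec (P : Matrix ι ι ℝ) (F : Matrix ι κ ℝ) (y : κ → ℝ) :
    quadForm P (F *ᵥ y) = quadForm (Fᵀ * P * F) y := by
  rw [quadForm, quadForm, ← mulVec_mulVec, ← mulVec_mulVec, dotProduct_mulVec y Fᵀ,
    vecMul_transpose]

lemma entry_eq_quadForm [DecidableEq ι] (hP : P.IsSymm) (i j : ι) :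
    P i j = (quadForm P (Pi.single i 1 + Pi.single j 1) - quadForm P (Pi.single i 1)
      - quadForm P (Pi.single j 1)) / 2 := by
  rw [quadForm_add]
  simp only [mulVec_single_one, single_one_dotProduct, col_apply, hP.apply i j]
  ring

lemma eq_of_quadForm_eq {P' : Matrix ι ι ℝ} (hP : P.IsSymm) (hP' : P'.IsSymm)
    (h : quadForm P = quadForm P') : P = P' := by
  classical
  ext i j
  rw [entry_eq_quadForm hP, entry_eq_quadForm hP', h]

lemma exists_tendsto_of_tendsto_quadForm {T : ℕ → Matrix ι ι ℝ} (hT : ∀ k, (T k).IsSymm)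
    (h : ∀ x, ∃ c, Tendsto (fun k ↦ quadForm (T k) x) atTop (𝓝 c)) :
    ∃ P, Tendsto T atTop (𝓝 P) := by
  classical
  choose g hg using h
  refine ⟨of fun i j ↦ (g (Pi.single i 1 + Pi.single j 1) - g (Pi.single i 1)
    - g (Pi.single j 1)) / 2, tendsto_pi_nhds.2 fun i ↦ tendsto_pi_nhds.2 fun j ↦ ?_⟩
  simp only [entry_eq_quadForm (hT _) i j, of_apply]
  exact (((hg _).sub (hg _)).sub (hg _)).div_const 2

@[fun_prop]
lemma continuous_quadForm (P : Matrix ι ι ℝ) : Continuous (quadForm P) := by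
  unfold quadForm
  fun_prop

@[fun_prop]
lemma continuous_quadForm_left (x : ι → ℝ) :
    Continuous fun P : Matrix ι ι ℝ ↦ quadForm P x := by
  unfold quadForm
  fun_prop

lemma tendsto_quadForm_zero {α : Type*} {l : Filter α} (P : Matrix ι ι ℝ) {x : α → ι → ℝ}
    (hx : Tendsto x l (𝓝 0)) : Tendsto (fun a ↦ quadForm P (x a)) l (𝓝 0) :=
  (continuous_quadForm P).tendsto' 0 0 (quadForm_zero P) |>.comp hx

lemma quadForm_pos (hP : P.PosDef) {x : ι → ℝ} (hx : x ≠ 0) : 0 < quadForm P x := by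
  simpa only [quadForm, star_trivial] using hP.dotProduct_mulVec_pos hx

lemma quadForm_nonneg (hP : P.PosSemidef) (x : ι → ℝ) : 0 ≤ quadForm P x := by
  simpa only [quadForm, star_trivial] using hP.dotProduct_mulVec_nonneg x

lemma posDef_of_quadForm_pos (hP : P.IsSymm) (h : ∀ x, x ≠ 0 → 0 < quadForm P x) : P.PosDef :=
  .of_dotProduct_mulVec_pos (isHermitian_iff_isSymm.2 hP) fun {x} hx ↦ by
    simpa only [quadForm, star_trivial] using h x hx

lemma posSemidef_of_quadForm_nonneg (hP : P.IsSymm) (h : ∀ x, 0 ≤ quadForm P x) :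
    P.PosSemidef :=
  .of_dotProduct_mulVec_nonneg (isHermitian_iff_isSymm.2 hP) fun x ↦ by
    simpa only [quadForm, star_trivial] using h x

lemma quadForm_eq_norm_sq_mul (P : Matrix ι ι ℝ) (x : ι → ℝ) :
    quadForm P x = ‖x‖ ^ 2 * quadForm P (‖x‖⁻¹ • x) := by
  rcases eq_or_ne x 0 with rfl | hx
  · simp
  · rw [← quadForm_smul, smul_inv_smul₀ (norm_ne_zero_iff.2 hx)]

lemma exists_abs_quadForm_le (P : Matrix ι ι ℝ) :
    ∃ C, 0 ≤ C ∧ ∀ x, |quadForm P x| ≤ C * ‖x‖ ^ 2 := by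
  obtain ⟨C, hC⟩ := (isCompact_closedBall (0 : ι → ℝ) 1).exists_bound_of_continuousOn
    (continuous_quadForm P).continuousOn
  refine ⟨C, (norm_nonneg _).trans (hC 0 (by simp)), fun x ↦ ?_⟩
  have hunit : ‖x‖⁻¹ • x ∈ Metric.closedBall (0 : ι → ℝ) 1 := by
    simpa [norm_smul] using inv_mul_le_one (a := ‖x‖)
  rw [quadForm_eq_norm_sq_mul, abs_mul, abs_sq, mul_comm]
  gcongr
  exact hC _ hunit

lemma exists_le_quadForm_of_posDef (hP : P.PosDef) :
    ∃ c, 0 < c ∧ ∀ x, c * ‖x‖ ^ 2 ≤ quadForm P x := by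
  obtain ⟨c, hc, hcP⟩ := (isCompact_sphere (0 : ι → ℝ) 1).exists_forall_le'
    (continuous_quadForm P).continuousOn (a := 0)
    fun x hx ↦ quadForm_pos hP (ne_zero_of_mem_unit_sphere ⟨x, hx⟩)
  refine ⟨c, hc, fun x ↦ ?_⟩
  rcases eq_or_ne x 0 with rfl | hx
  · simp
  · rw [quadForm_eq_norm_sq_mul, mul_comm]
    gcongr
    exact hcP _ (by simp [norm_smul, hx])

lemma exists_quadForm_le_mul (P : Matrix ι ι ℝ) {E : Matrix ι ι ℝ} (hE : E.PosDef) :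
    ∃ C, 0 ≤ C ∧ ∀ x, quadForm P x ≤ C * quadForm E x := by
  obtain ⟨c, hc, hcE⟩ := exists_le_quadForm_of_posDef hE
  obtain ⟨C, hC, hCP⟩ := exists_abs_quadForm_le P
  refine ⟨C / c, by positivity, fun x ↦ ?_⟩
  calc quadForm P x ≤ C * ‖x‖ ^ 2 := (le_abs_self _).trans (hCP x)
    _ = C / c * (c * ‖x‖ ^ 2) := by field_simp
    _ ≤ C / c * quadForm E x := by gcongr; exact hcE x

lemma tendsto_zero_of_tendsto_quadForm {α : Type*} {l : Filter α} (hP : P.PosDef)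
    {x : α → ι → ℝ} (h : Tendsto (fun a ↦ quadForm P (x a)) l (𝓝 0)) : Tendsto x l (𝓝 0) := by
  obtain ⟨c, hc, hcP⟩ := exists_le_quadForm_of_posDef hP
  have hsq : Tendsto (fun a ↦ ‖x a‖ ^ 2) l (𝓝 0) :=
    squeeze_zero (fun a ↦ by positivity) (fun a ↦ (le_div_iff₀' hc).2 (hcP (x a)))
      (by simpa using h.div_const c)
  exact tendsto_zero_iff_norm_tendsto_zero.2 (by simpa using hsq.sqrt)

lemma posSemidef_of_tendsto {ι α : Type*} [Finite ι] {l : Filter α} [l.NeBot]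
    {T : α → Matrix ι ι ℝ} {P : Matrix ι ι ℝ} (hT : ∀ a, (T a).PosSemidef)
    (hP : Tendsto T l (𝓝 P)) : P.PosSemidef := by
  cases nonempty_fintype ι
  have hsymm : P.IsSymm := by
    refine tendsto_nhds_unique ((continuous_id.matrix_transpose.tendsto P).comp hP) ?_
    exact hP.congr fun a ↦ (isHermitian_iff_isSymm.1 (hT a).isHermitian).eq.symm
  exact posSemidef_of_quadForm_nonneg hsymm fun x ↦
    ge_of_tendsto' ((continuous_quadForm_left x).continuousAt.tendsto.comp hP)
      fun a ↦ quadForm_nonneg (hT a) x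

end QuadForm

section SchurStability

open scoped Matrix.Norms.Operator NNReal ENNReal

lemma summable_norm_pow_of_spectralRadius_lt_one {𝔸 : Type*} [NormedRing 𝔸] [NormedAlgebra ℂ 𝔸]
    [CompleteSpace 𝔸] {a : 𝔸} (ha : spectralRadius ℂ a < 1) : Summable fun k ↦ ‖a ^ k‖ := by
  obtain ⟨r, har, hr1⟩ := ENNReal.lt_iff_exists_nnreal_btwn.1 ha
  have hle : ∀ᶠ k : ℕ in atTop, ‖a ^ k‖ ≤ (r : ℝ) ^ k := by
    filter_upwards [(spectrum.pow_nnnorm_pow_one_div_tendsto_nhds_spectralRadius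
      a).eventually_lt_const har, eventually_ne_atTop 0] with k hroot hk
    have hpow := ENNReal.rpow_le_rpow hroot.le (Nat.cast_nonneg k)
    rw [← ENNReal.rpow_mul, one_div_mul_cancel (Nat.cast_ne_zero.2 hk), ENNReal.rpow_one,
      ENNReal.rpow_natCast] at hpow
    exact_mod_cast hpow
  have hgeom : Summable fun k : ℕ ↦ (r : ℝ) ^ k :=
    summable_geometric_of_lt_one r.coe_nonneg (by exact_mod_cast hr1)
  exact hgeom.of_norm_bounded_eventually_nat (by simpa only [norm_norm] using hle)

variable {n : ℕ} {M P : Matrix (Fin n) (Fin n) ℝ}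

lemma norm_map_algebraMap_complex (M : Matrix (Fin n) (Fin n) ℝ) :
    ‖M.map (algebraMap ℝ ℂ)‖ = ‖M‖ := by
  simp [linfty_opNorm_def]

namespace IsSchurStable

lemma summable_norm_pow (hM : IsSchurStable M) : Summable fun k ↦ ‖M ^ k‖ := by
  cases isEmpty_or_nonempty (Fin n)
  · simpa only [Subsingleton.elim _ (0 : Matrix (Fin n) (Fin n) ℝ), norm_zero]
      using summable_zero
  have hradius : spectralRadius ℂ (M.map (algebraMap ℝ ℂ)) < 1 :=
    spectrum.spectralRadius_lt_of_forall_lt (r := 1) _ fun μ hμ ↦ by exact_mod_cast hM μ hμ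
  refine (summable_norm_pow_of_spectralRadius_lt_one hradius).congr fun k ↦ ?_
  rw [← norm_map_algebraMap_complex (M ^ k)]
  exact congrArg norm (map_pow (algebraMap ℝ ℂ).mapMatrix M k).symm

lemma tendsto_pow_mulVec (hM : IsSchurStable M) (x : Fin n → ℝ) :
    Tendsto (fun k ↦ M ^ k *ᵥ x) atTop (𝓝 0) := by
  refine squeeze_zero_norm (fun k ↦ linfty_opNorm_mulVec (M ^ k) x) ?_
  simpa only [zero_mul] using hM.summable_norm_pow.tendsto_atTop_zero.mul_const ‖x‖

lemma summable_quadForm_pow_mulVec (hM : IsSchurStable M) (G : Matrix (Fin n) (Fin n) ℝ)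
    (x : Fin n → ℝ) : Summable fun k ↦ quadForm G (M ^ k *ᵥ x) := by
  obtain ⟨C, hC, hCG⟩ := exists_abs_quadForm_le G
  refine ((hM.summable_norm_pow.mul_right ‖x‖).mul_left C).of_norm_bounded_eventually_nat ?_
  filter_upwards [(hM.tendsto_pow_mulVec x).norm.eventually_le_const
    (norm_zero.trans_lt one_pos)] with k hk
  calc ‖quadForm G (M ^ k *ᵥ x)‖ ≤ C * ‖M ^ k *ᵥ x‖ ^ 2 := hCG _
    _ ≤ C * ‖M ^ k *ᵥ x‖ := by
      gcongr
      exact pow_le_of_le_one (norm_nonneg _) hk two_ne_zero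
    _ ≤ C * (‖M ^ k‖ * ‖x‖) := by
      gcongr
      exact linfty_opNorm_mulVec (M ^ k) x

lemma apply_zero_le (hM : IsSchurStable M) {f : (Fin n → ℝ) → ℝ} (hf : ContinuousAt f 0)
    (hle : ∀ x, f (M *ᵥ x) ≤ f x) (x : Fin n → ℝ) : f 0 ≤ f x := by
  refine le_of_tendsto' (hf.tendsto.comp (hM.tendsto_pow_mulVec x)) fun k ↦ ?_
  induction k with
  | zero => simp
  | succ k ih =>
    rw [Function.comp_apply, pow_succ', ← mulVec_mulVec]
    exact (hle _).trans ih

lemma isAsymptoticallyStableEquilibrium (hM : IsSchurStable M) :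
    IsAsymptoticallyStableEquilibrium (M *ᵥ ·) 0 := by
  have iterate_eq (k : ℕ) (x : Fin n → ℝ) : (M *ᵥ ·)^[k] x = M ^ k *ᵥ x := by
    induction k with
    | zero => simp
    | succ k ih => rw [Function.iterate_succ_apply', ih, mulVec_mulVec, ← pow_succ']
  refine ⟨mulVec_zero M, fun U hU ↦ ?_, .of_forall fun x ↦ ?_⟩
  · obtain ⟨ε, hε, hεU⟩ := Metric.mem_nhds_iff.1 hU
    set T := ∑' k, ‖M ^ k‖
    have hTpos : 0 < T + 1 := add_pos_of_nonneg_of_pos (tsum_nonneg fun k ↦ norm_nonneg _) one_pos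
    have norm_pow_le (k : ℕ) : ‖M ^ k‖ ≤ T + 1 :=
      (hM.summable_norm_pow.le_tsum k fun j _ ↦ norm_nonneg _).trans (lt_add_one T).le
    refine ⟨Metric.ball 0 (ε / (T + 1)), Metric.ball_mem_nhds _ (by positivity),
      fun x hx k ↦ hεU ?_⟩
    rw [mem_ball_zero_iff] at hx ⊢
    calc ‖(M *ᵥ ·)^[k] x‖ = ‖M ^ k *ᵥ x‖ := by rw [iterate_eq]
      _ ≤ ‖M ^ k‖ * ‖x‖ := linfty_opNorm_mulVec _ _
      _ ≤ (T + 1) * ‖x‖ := by gcongr; exact norm_pow_le k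
      _ < (T + 1) * (ε / (T + 1)) := by gcongr
      _ = ε := by field_simp
  · simpa only [iterate_eq] using hM.tendsto_pow_mulVec x

end IsSchurStable

lemma re_map_mulVec (M : Matrix (Fin n) (Fin n) ℝ) (z : Fin n → ℂ) :
    Complex.re ∘ (M.map (algebraMap ℝ ℂ) *ᵥ z) = M *ᵥ (Complex.re ∘ z) := by
  ext i
  simp [mulVec, dotProduct]

lemma im_map_mulVec (M : Matrix (Fin n) (Fin n) ℝ) (z : Fin n → ℂ) :
    Complex.im ∘ (M.map (algebraMap ℝ ℂ) *ᵥ z) = M *ᵥ (Complex.im ∘ z) := by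
  ext i
  simp [mulVec, dotProduct]

lemma quadForm_re_add_quadForm_im_smul {ι : Type*} [Fintype ι] (P : Matrix ι ι ℝ) (c : ℂ)
    (z : ι → ℂ) :
    quadForm P (Complex.re ∘ (c • z)) + quadForm P (Complex.im ∘ (c • z))
      = ‖c‖ ^ 2 * (quadForm P (Complex.re ∘ z) + quadForm P (Complex.im ∘ z)) := by
  have hre : Complex.re ∘ (c • z) = c.re • (Complex.re ∘ z) + (-c.im) • (Complex.im ∘ z) := by
    ext i
    simp [sub_eq_add_neg]
  have him : Complex.im ∘ (c • z) = c.re • (Complex.im ∘ z) + c.im • (Complex.re ∘ z) := by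
    ext i
    simp
  rw [hre, him, quadForm_add, quadForm_add, Complex.sq_norm, Complex.normSq_apply]
  simp only [quadForm_smul, mulVec_smul, dotProduct_smul, smul_dotProduct, smul_eq_mul]
  ring

lemma quadForm_mulVec_le_of_lt (hlt : ∀ x, x ≠ 0 → quadForm P (M *ᵥ x) < quadForm P x)
    (x : Fin n → ℝ) : quadForm P (M *ᵥ x) ≤ quadForm P x := by
  rcases eq_or_ne x 0 with rfl | hx
  · simp
  · exact (hlt x hx).le

lemma isSchurStable_of_quadForm_mulVec_lt (hP : P.PosDef)
    (hlt : ∀ x, x ≠ 0 → quadForm P (M *ᵥ x) < quadForm P x) : IsSchurStable M := by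
  intro μ hμ
  rw [← spectrum_toLin', ← Module.End.hasEigenvalue_iff_mem_spectrum] at hμ
  obtain ⟨z, hz⟩ := hμ.exists_hasEigenvector
  have hMz : M.map (algebraMap ℝ ℂ) *ᵥ z = μ • z := by simpa using hz.apply_eq_smul
  set a := Complex.re ∘ z with ha
  set b := Complex.im ∘ z with hb
  have hscale : quadForm P (M *ᵥ a) + quadForm P (M *ᵥ b)
      = ‖μ‖ ^ 2 * (quadForm P a + quadForm P b) := by
    rw [ha, hb, ← re_map_mulVec, ← im_map_mulVec, hMz, quadForm_re_add_quadForm_im_smul]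
  have hle := quadForm_mulVec_le_of_lt hlt
  have hab : a ≠ 0 ∨ b ≠ 0 := by
    by_contra! h
    exact hz.2 (funext fun i ↦ Complex.ext (congrFun h.1 i) (congrFun h.2 i))
  have hdecrease : ‖μ‖ ^ 2 * (quadForm P a + quadForm P b) < quadForm P a + quadForm P b := by
    rw [← hscale]
    rcases hab with h | h
    · exact add_lt_add_of_lt_of_le (hlt a h) (hle b)
    · exact add_lt_add_of_le_of_lt (hle a) (hlt b h)
  have hnonneg := add_nonneg (quadForm_nonneg hP.posSemidef a) (quadForm_nonneg hP.posSemidef b)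
  by_contra! hμ1
  exact hdecrease.not_ge (le_mul_of_one_le_left hnonneg (one_le_pow₀ hμ1))

lemma isSchurStable_iff_posDef (hP : P.IsSymm)
    (hlt : ∀ x, x ≠ 0 → quadForm P (M *ᵥ x) < quadForm P x) : IsSchurStable M ↔ P.PosDef := by
  refine ⟨fun hM ↦ posDef_of_quadForm_pos hP fun x hx ↦ ?_,
    fun hP ↦ isSchurStable_of_quadForm_mulVec_lt hP hlt⟩
  calc 0 = quadForm P 0 := (quadForm_zero P).symm
    _ ≤ quadForm P (M *ᵥ x) := hM.apply_zero_le (continuous_quadForm P).continuousAt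
      (quadForm_mulVec_le_of_lt hlt) _
    _ < quadForm P x := hlt x hx

namespace IsAntistable

lemma isUnit_det (hM : IsAntistable M) : IsUnit M.det := by
  have hunit : IsUnit (M.map (algebraMap ℝ ℂ)) := by
    by_contra h
    have : 1 < ‖(0 : ℂ)‖ := hM 0 (spectrum.zero_mem ℂ h)
    exact this.not_gt (norm_zero.trans_lt one_pos)
  have hdet : (M.map (algebraMap ℝ ℂ)).det = algebraMap ℝ ℂ M.det :=
    ((algebraMap ℝ ℂ).map_det M).symm
  rw [isUnit_iff_isUnit_det, hdet] at hunit
  exact (isUnit_map_iff _ _).1 hunit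

lemma isSchurStable_inv (hM : IsAntistable M) : IsSchurStable M⁻¹ := by
  obtain ⟨M, rfl⟩ := (isUnit_iff_isUnit_det M).2 hM.isUnit_det
  let Mc := Units.map (algebraMap ℝ ℂ).mapMatrix.toMonoidHom M
  intro μ hμ
  have hμinv : μ ∈ spectrum ℂ (↑Mc⁻¹ : Matrix (Fin n) (Fin n) ℂ) := by
    rwa [← coe_units_inv] at hμ
  have hμ0 : μ ≠ 0 := spectrum.ne_zero_of_mem_of_unit hμinv
  have hnorm : 1 < ‖μ⁻¹‖ := hM _ (spectrum.inv₀_mem_iff.2 hμinv)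
  rw [norm_inv] at hnorm
  exact (one_lt_inv₀ (norm_pos_iff.2 hμ0)).1 hnorm

end IsAntistable

end SchurStability

namespace LQProblem

variable {n m : ℕ}

section CompletionOfSquares

variable (p : LQProblem n m) {P : Matrix (Fin n) (Fin n) ℝ}

/-- The matrix `R + Bᵀ P B` that weights the input in the one-step problem with terminal cost
matrix `P`. -/
def inputWeight (P : Matrix (Fin n) (Fin n) ℝ) : Matrix (Fin m) (Fin m) ℝ :=
  p.R + p.Bᵀ * P * p.B

/-- The Riccati operator, i.e. the right-hand side of the DARE. -/
def riccati (P : Matrix (Fin n) (Fin n) ℝ) : Matrix (Fin n) (Fin n) ℝ :=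
  p.Q + p.Aᵀ * P * p.A - (p.Sᵀ + p.Aᵀ * P * p.B) * p.gain P

/-- The cost matrix of the one-step problem with terminal cost matrix `P`, i.e. the matrix of the
quadratic form `ℓ(x,u) + (A x + B u)ᵀ P (A x + B u)` in `(x,u)`. -/
def lookaheadH (P : Matrix (Fin n) (Fin n) ℝ) : Matrix (Fin n ⊕ Fin m) (Fin n ⊕ Fin m) ℝ :=
  p.H + (fromCols p.A p.B)ᵀ * P * fromCols p.A p.B

lemma quadForm_lookaheadH (P : Matrix (Fin n) (Fin n) ℝ) (x : Fin n → ℝ) (u : Fin m → ℝ) :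
    quadForm (p.lookaheadH P) (Sum.elim x u)
      = p.stageCost x u + quadForm P (p.A *ᵥ x + p.B *ᵥ u) := by
  rw [lookaheadH, quadForm_add_left, ← quadForm_mulVec, fromCols_mulVec_sumElim]
  rfl

lemma transpose_cross (hP : P.IsSymm) :
    (p.S + p.Bᵀ * P * p.A)ᵀ = p.Sᵀ + p.Aᵀ * P * p.B := by
  simp only [transpose_add, transpose_mul, transpose_transpose, hP.eq, Matrix.mul_assoc]

lemma lookaheadH_eq_fromBlocks (hP : P.IsSymm) :
    p.lookaheadH P = fromBlocks (p.Q + p.Aᵀ * P * p.A) (p.S + p.Bᵀ * P * p.A)ᵀ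
      (p.S + p.Bᵀ * P * p.A) (p.inputWeight P) := by
  rw [lookaheadH, H, transpose_fromCols, fromRows_mul, fromRows_mul_fromCols, fromBlocks_add,
    p.transpose_cross hP, inputWeight]

lemma riccati_eq_schurComplement (hP : P.IsSymm) :
    p.riccati P = p.Q + p.Aᵀ * P * p.A
      - (p.S + p.Bᵀ * P * p.A)ᵀ * (p.inputWeight P)⁻¹ * (p.S + p.Bᵀ * P * p.A) := by
  rw [riccati, gain, p.transpose_cross hP, inputWeight, ← Matrix.mul_assoc]

lemma inputWeight_isSymm (hP : P.IsSymm) : (p.inputWeight P).IsSymm := by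
  simp only [inputWeight, IsSymm, transpose_add, transpose_mul, transpose_transpose, hP.eq,
    p.R_symm.eq, Matrix.mul_assoc]

lemma riccati_isSymm (hP : P.IsSymm) : (p.riccati P).IsSymm := by
  rw [p.riccati_eq_schurComplement hP]
  simp only [IsSymm, transpose_sub, transpose_add, transpose_mul, transpose_transpose, hP.eq,
    p.Q_symm.eq, transpose_nonsing_inv, (p.inputWeight_isSymm hP).eq, Matrix.mul_assoc]

lemma stageCost_add_quadForm (hP : P.IsSymm) (hW : IsUnit (p.inputWeight P)) (x : Fin n → ℝ)
    (u : Fin m → ℝ) :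
    p.stageCost x u + quadForm P (p.A *ᵥ x + p.B *ᵥ u)
      = quadForm (p.riccati P) x + quadForm (p.inputWeight P) (u + p.gain P *ᵥ x) := by
  have := hW.invertible
  have schur := schur_complement_eq₂₂ (p.Q + p.Aᵀ * P * p.A) (p.S + p.Bᵀ * P * p.A)ᵀ x u
    (isHermitian_iff_isSymm.2 (p.inputWeight_isSymm hP))
  simp only [conjTranspose_eq_transpose_of_trivial, transpose_transpose, star_trivial,
    ← dotProduct_mulVec] at schur
  rw [← quadForm_lookaheadH, p.lookaheadH_eq_fromBlocks hP, p.riccati_eq_schurComplement hP,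
    add_comm (quadForm _ x), add_comm u]
  exact schur

lemma mulVec_add_mulVec_neg (K : Matrix (Fin m) (Fin n) ℝ) (x : Fin n → ℝ) :
    p.A *ᵥ x + p.B *ᵥ (-(K *ᵥ x)) = (p.A - p.B * K) *ᵥ x := by
  rw [mulVec_neg, mulVec_mulVec, sub_mulVec, sub_eq_add_neg]

lemma quadForm_riccati (hP : P.IsSymm) (hW : IsUnit (p.inputWeight P)) (x : Fin n → ℝ) :
    quadForm (p.riccati P) x = p.stageCost x (-(p.gain P *ᵥ x))
      + quadForm P ((p.A - p.B * p.gain P) *ᵥ x) := by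
  rw [← mulVec_add_mulVec_neg, p.stageCost_add_quadForm hP hW, neg_add_cancel, quadForm_zero,
    add_zero]

lemma continuousAt_riccati (hW : IsUnit (p.inputWeight P)) : ContinuousAt p.riccati P := by
  have hinv : ContinuousAt (fun P ↦ (p.inputWeight P)⁻¹) P := by
    have hdet : ContinuousAt Ring.inverse (p.inputWeight P).det := by
      rw [Ring.inverse_eq_inv']
      exact continuousAt_inv₀ ((isUnit_iff_isUnit_det _).1 hW).ne_zero
    refine ContinuousAt.comp (f := p.inputWeight) (continuousAt_matrix_inv _ hdet) ?_
    unfold inputWeight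
    fun_prop
  have hjoint : Continuous fun q : Matrix (Fin n) (Fin n) ℝ × Matrix (Fin m) (Fin m) ℝ ↦
      p.Q + p.Aᵀ * q.1 * p.A
        - (p.Sᵀ + p.Aᵀ * q.1 * p.B) * (q.2 * (p.S + p.Bᵀ * q.1 * p.A)) := by
    fun_prop
  exact hjoint.continuousAt.comp (f := fun P ↦ (P, (p.inputWeight P)⁻¹))
    (continuousAt_id.prodMk hinv)

end CompletionOfSquares

section HorizonCost

variable (p : LQProblem n m) {P : Matrix (Fin n) (Fin n) ℝ}

lemma horizonCost_zero (P : Matrix (Fin n) (Fin n) ℝ) (x₀ : Fin n → ℝ) (u : ℕ → Fin m → ℝ) :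
    p.horizonCost P x₀ u 0 = quadForm P x₀ := by
  simp only [horizonCost, Finset.sum_range_zero, zero_add, state, quadForm]

lemma horizonCost_add (P P' : Matrix (Fin n) (Fin n) ℝ) (x₀ : Fin n → ℝ) (u : ℕ → Fin m → ℝ)
    (N : ℕ) :
    p.horizonCost (P + P') x₀ u N = p.horizonCost P x₀ u N + quadForm P' (p.state x₀ u N) := by
  rw [horizonCost, horizonCost, add_mulVec, dotProduct_add, add_assoc, quadForm]

lemma horizonCost_succ (hP : P.IsSymm) (hW : IsUnit (p.inputWeight P)) (x₀ : Fin n → ℝ)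
    (u : ℕ → Fin m → ℝ) (N : ℕ) :
    p.horizonCost P x₀ u (N + 1) = p.horizonCost (p.riccati P) x₀ u N
      + quadForm (p.inputWeight P) (u N + p.gain P *ᵥ p.state x₀ u N) := by
  have square := p.stageCost_add_quadForm hP hW (p.state x₀ u N) (u N)
  rw [horizonCost, horizonCost, Finset.sum_range_succ, add_assoc, add_assoc]
  exact congrArg _ square

variable {p} in
lemma IsDARESolution.riccati_eq (hP : p.IsDARESolution P) : p.riccati P = P := hP.eq.symm

lemma isDARESolution_iff :
    p.IsDARESolution P ↔ P.IsSymm ∧ IsUnit (p.inputWeight P) ∧ p.riccati P = P :=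
  ⟨fun h ↦ ⟨h.symm, h.isUnit, h.riccati_eq⟩, fun ⟨hsymm, hunit, heq⟩ ↦ ⟨hsymm, hunit, heq.symm⟩⟩

variable {p} in
lemma IsDARESolution.horizonCost_eq (hP : p.IsDARESolution P) (x₀ : Fin n → ℝ)
    (u : ℕ → Fin m → ℝ) (N : ℕ) :
    p.horizonCost P x₀ u N = quadForm P x₀ + ∑ k ∈ Finset.range N,
      quadForm (p.inputWeight P) (u k + p.gain P *ᵥ p.state x₀ u k) := by
  induction N with
  | zero => rw [horizonCost_zero, Finset.sum_range_zero, add_zero]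
  | succ N ih =>
    rw [p.horizonCost_succ hP.symm hP.isUnit, hP.riccati_eq, ih, Finset.sum_range_succ, add_assoc]

variable {p} in
lemma IsDARESolution.quadForm_le_horizonCost (hP : p.IsDARESolution P)
    (hW : (p.inputWeight P).PosDef) (x₀ : Fin n → ℝ) (u : ℕ → Fin m → ℝ) (N : ℕ) :
    quadForm P x₀ ≤ p.horizonCost P x₀ u N := by
  rw [hP.horizonCost_eq]
  exact le_add_of_nonneg_right (Finset.sum_nonneg fun k _ ↦ quadForm_nonneg hW.posSemidef _)

/-- The input sequence generated by the feedback law `u = -K x` from the initial value `x₀`. -/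
def feedbackInput (K : Matrix (Fin m) (Fin n) ℝ) (x₀ : Fin n → ℝ) (k : ℕ) : Fin m → ℝ :=
  -(K *ᵥ ((p.A - p.B * K) ^ k *ᵥ x₀))

lemma state_feedbackInput (K : Matrix (Fin m) (Fin n) ℝ) (x₀ : Fin n → ℝ) (k : ℕ) :
    p.state x₀ (p.feedbackInput K x₀) k = (p.A - p.B * K) ^ k *ᵥ x₀ := by
  induction k with
  | zero => simp [state]
  | succ k ih =>
    rw [state, ih, feedbackInput, mulVec_add_mulVec_neg, mulVec_mulVec, ← pow_succ']

variable {p} in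
lemma state_eq_pow_mulVec {K : Matrix (Fin m) (Fin n) ℝ} {x₀ : Fin n → ℝ} {u : ℕ → Fin m → ℝ}
    (hu : ∀ k, u k = -(K *ᵥ p.state x₀ u k)) (k : ℕ) :
    p.state x₀ u k = (p.A - p.B * K) ^ k *ᵥ x₀ := by
  induction k with
  | zero => simp [state]
  | succ k ih =>
    rw [state, hu k, mulVec_add_mulVec_neg, ih, mulVec_mulVec, ← pow_succ']

variable {p} in
lemma eq_feedbackInput_iff {K : Matrix (Fin m) (Fin n) ℝ} {x₀ : Fin n → ℝ}
    {u : ℕ → Fin m → ℝ} :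
    u = p.feedbackInput K x₀ ↔ ∀ k, u k = -(K *ᵥ p.state x₀ u k) := by
  refine ⟨?_, fun hu ↦ funext fun k ↦ ?_⟩
  · rintro rfl k
    rw [state_feedbackInput, feedbackInput]
  · rw [hu k, state_eq_pow_mulVec hu k, feedbackInput]

end HorizonCost

section PosDefCost

variable {p : LQProblem n m} {P : Matrix (Fin n) (Fin n) ℝ}

lemma stageCost_pos (hH : p.H.PosDef) {x : Fin n → ℝ} (hx : x ≠ 0) (u : Fin m → ℝ) :
    0 < p.stageCost x u :=
  quadForm_pos hH fun h ↦ hx <| funext fun i ↦ congrFun h (Sum.inl i)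

lemma stageCost_nonneg (hH : p.H.PosDef) (x : Fin n → ℝ) (u : Fin m → ℝ) :
    0 ≤ p.stageCost x u :=
  quadForm_nonneg hH.posSemidef _

lemma tendsto_state_zero_of_summable (hH : p.H.PosDef) {x₀ : Fin n → ℝ} {u : ℕ → Fin m → ℝ}
    (h : Summable fun k ↦ p.stageCost (p.state x₀ u k) (u k)) :
    Tendsto (p.state x₀ u) atTop (𝓝 0) := by
  have hxu := tendsto_zero_of_tendsto_quadForm hH h.tendsto_atTop_zero
  exact tendsto_pi_nhds.2 fun i ↦ tendsto_pi_nhds.1 hxu (Sum.inl i)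

lemma inputWeight_posDef (hH : p.H.PosDef) (hP : P.PosSemidef) : (p.inputWeight P).PosDef := by
  have hlookahead : (p.lookaheadH P).PosDef := hH.add_posSemidef <| by
    simpa only [conjTranspose_eq_transpose_of_trivial]
      using hP.conjTranspose_mul_mul_same (fromCols p.A p.B)
  rw [p.lookaheadH_eq_fromBlocks (isHermitian_iff_isSymm.1 hP.isHermitian)] at hlookahead
  exact hlookahead.submatrix Sum.inr_injective

lemma quadForm_riccati_le (hH : p.H.PosDef) (hP : P.PosSemidef) (x : Fin n → ℝ)
    (u : Fin m → ℝ) :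
    quadForm (p.riccati P) x ≤ p.stageCost x u + quadForm P (p.A *ᵥ x + p.B *ᵥ u) := by
  have hW := inputWeight_posDef hH hP
  rw [p.stageCost_add_quadForm (isHermitian_iff_isSymm.1 hP.isHermitian) hW.isUnit]
  exact le_add_of_nonneg_right (quadForm_nonneg hW.posSemidef _)

lemma riccati_posDef (hH : p.H.PosDef) (hP : P.PosSemidef) : (p.riccati P).PosDef := by
  have hsymm := isHermitian_iff_isSymm.1 hP.isHermitian
  refine posDef_of_quadForm_pos (p.riccati_isSymm hsymm) fun x hx ↦ ?_
  rw [p.quadForm_riccati hsymm (inputWeight_posDef hH hP).isUnit]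
  exact add_pos_of_pos_of_nonneg (stageCost_pos hH hx _) (quadForm_nonneg hP _)

lemma quadForm_riccati_mono (hH : p.H.PosDef) {P' : Matrix (Fin n) (Fin n) ℝ}
    (hP : P.PosSemidef) (hP' : P'.PosSemidef) (hle : quadForm P ≤ quadForm P') :
    quadForm (p.riccati P) ≤ quadForm (p.riccati P') := fun x ↦ by
  calc quadForm (p.riccati P) x
      ≤ p.stageCost x (-(p.gain P' *ᵥ x))
        + quadForm P (p.A *ᵥ x + p.B *ᵥ (-(p.gain P' *ᵥ x))) := quadForm_riccati_le hH hP _ _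
    _ ≤ p.stageCost x (-(p.gain P' *ᵥ x))
        + quadForm P' ((p.A - p.B * p.gain P') *ᵥ x) := by
      rw [mulVec_add_mulVec_neg]
      gcongr
      exact hle _
    _ = quadForm (p.riccati P') x :=
      (p.quadForm_riccati (isHermitian_iff_isSymm.1 hP'.isHermitian)
        (inputWeight_posDef hH hP').isUnit x).symm

namespace IsDARESolution

lemma quadForm_closedLoop_lt (hP : p.IsDARESolution P) (hH : p.H.PosDef) {x : Fin n → ℝ}
    (hx : x ≠ 0) : quadForm P ((p.A - p.B * p.gain P) *ᵥ x) < quadForm P x := by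
  have hdecrease := p.quadForm_riccati hP.symm hP.isUnit x
  rw [hP.riccati_eq] at hdecrease
  exact hdecrease ▸ lt_add_of_pos_left _ (stageCost_pos hH hx _)

lemma isStabilizingSolution_iff_posDef (hP : p.IsDARESolution P) (hH : p.H.PosDef) :
    p.IsStabilizingSolution P ↔ P.PosDef := by
  rw [IsStabilizingSolution, and_iff_right hP]
  exact isSchurStable_iff_posDef hP.symm fun x ↦ hP.quadForm_closedLoop_lt hH

end IsDARESolution

section ValueIteration

lemma iterate_riccati_posSemidef (hH : p.H.PosDef) (hP : P.PosSemidef) (k : ℕ) :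
    (p.riccati^[k] P).PosSemidef := by
  induction k with
  | zero => exact hP
  | succ k ih =>
    rw [Function.iterate_succ_apply']
    exact (riccati_posDef hH ih).posSemidef

lemma monotone_quadForm_iterate_riccati (hH : p.H.PosDef) :
    Monotone fun k ↦ quadForm (p.riccati^[k] 0) := by
  have hpsd := iterate_riccati_posSemidef hH .zero
  refine monotone_nat_of_le_succ fun k ↦ ?_
  induction k with
  | zero =>
    intro x
    rw [Function.iterate_zero_apply, quadForm_zero_left]
    exact quadForm_nonneg (hpsd 1) x
  | succ k ih =>
    have hstep := quadForm_riccati_mono hH (hpsd k) (hpsd (k + 1)) ih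
    rwa [← Function.iterate_succ_apply' p.riccati k,
      ← Function.iterate_succ_apply' p.riccati (k + 1)] at hstep

lemma quadForm_iterate_riccati_le_horizonCost (hH : p.H.PosDef) (hP : P.PosSemidef)
    (x₀ : Fin n → ℝ) (u : ℕ → Fin m → ℝ) (k : ℕ) :
    quadForm (p.riccati^[k] P) x₀ ≤ p.horizonCost P x₀ u k := by
  induction k generalizing P with
  | zero => rw [Function.iterate_zero_apply, horizonCost_zero]
  | succ k ih =>
    have hW := inputWeight_posDef hH hP
    rw [p.horizonCost_succ (isHermitian_iff_isSymm.1 hP.isHermitian) hW.isUnit,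
      Function.iterate_succ_apply]
    exact le_add_of_le_of_nonneg (ih (riccati_posDef hH hP).posSemidef)
      (quadForm_nonneg hW.posSemidef _)

variable (p) in
lemma exists_stageCost_feedback_eq_quadForm (K : Matrix (Fin m) (Fin n) ℝ) :
    ∃ G, ∀ x, p.stageCost x (-(K *ᵥ x)) = quadForm G x := by
  let F : Matrix (Fin n ⊕ Fin m) (Fin n) ℝ := fromRows 1 (-K)
  refine ⟨Fᵀ * p.H * F, fun x ↦ ?_⟩
  rw [← quadForm_mulVec, fromRows_mulVec, one_mulVec, neg_mulVec]
  rfl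

lemma bddAbove_horizonCost_feedbackInput {K : Matrix (Fin m) (Fin n) ℝ}
    (hK : IsSchurStable (p.A - p.B * K)) (x₀ : Fin n → ℝ) :
    BddAbove (Set.range (p.horizonCost 0 x₀ (p.feedbackInput K x₀))) := by
  obtain ⟨G, hG⟩ := p.exists_stageCost_feedback_eq_quadForm K
  have hcost (N : ℕ) : p.horizonCost 0 x₀ (p.feedbackInput K x₀) N
      = ∑ k ∈ Finset.range N, quadForm G ((p.A - p.B * K) ^ k *ᵥ x₀) := by
    simp only [horizonCost, state_feedbackInput, feedbackInput, hG, zero_mulVec, dotProduct_zero,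
      add_zero]
  rw [funext hcost]
  exact (hK.summable_quadForm_pow_mulVec G x₀).hasSum.tendsto_sum_nat.bddAbove_range

lemma exists_tendsto_iterate_riccati (hH : p.H.PosDef) (hstab : p.IsStabilizable) :
    ∃ P, Tendsto (fun k ↦ p.riccati^[k] 0) atTop (𝓝 P) := by
  obtain ⟨K, hK⟩ := hstab
  have hpsd := iterate_riccati_posSemidef hH .zero
  refine exists_tendsto_of_tendsto_quadForm
    (fun k ↦ isHermitian_iff_isSymm.1 (hpsd k).isHermitian) fun x ↦ ?_
  obtain ⟨C, hC⟩ := bddAbove_horizonCost_feedbackInput hK x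
  refine ⟨_, tendsto_atTop_ciSup (fun i j hij ↦ monotone_quadForm_iterate_riccati hH hij x)
    ⟨C, ?_⟩⟩
  rintro _ ⟨k, rfl⟩
  exact (quadForm_iterate_riccati_le_horizonCost hH .zero x _ k).trans (hC ⟨k, rfl⟩)

lemma exists_isStabilizingSolution_of_posDef (hH : p.H.PosDef) (hstab : p.IsStabilizable) :
    ∃ P, p.IsStabilizingSolution P := by
  obtain ⟨P, hP⟩ := exists_tendsto_iterate_riccati hH hstab
  have hpsd := posSemidef_of_tendsto (iterate_riccati_posSemidef hH .zero) hP
  have hW := inputWeight_posDef hH hpsd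
  have hfixed : p.riccati P = P :=
    isFixedPt_of_tendsto_iterate hP (p.continuousAt_riccati hW.isUnit)
  have hdare : p.IsDARESolution P :=
    p.isDARESolution_iff.2 ⟨isHermitian_iff_isSymm.1 hpsd.isHermitian, hW.isUnit, hfixed⟩
  exact ⟨P, (hdare.isStabilizingSolution_iff_posDef hH).2 (hfixed ▸ riccati_posDef hH hpsd)⟩

end ValueIteration

/-- With the terminal cost matrix `Pf`, only inputs that drive the state to the origin can avoid
the cost `+∞`. -/
def ForcesConvergence (p : LQProblem n m) (Pf : Matrix (Fin n) (Fin n) ℝ) : Prop :=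
  ∀ x₀ u, ¬Tendsto (p.horizonCost Pf x₀ u) atTop atTop → Tendsto (p.state x₀ u) atTop (𝓝 0)

namespace IsAntistabilizingSolution

lemma neg_posDef (hP : p.IsAntistabilizingSolution P) (hH : p.H.PosDef) : (-P).PosDef := by
  refine (isSchurStable_iff_posDef hP.1.symm.neg fun y hy ↦ ?_).1 hP.2.isSchurStable_inv
  set M := p.A - p.B * p.gain P with hM
  have hMy : M *ᵥ (M⁻¹ *ᵥ y) = y := by
    rw [mulVec_mulVec, mul_nonsing_inv _ hP.2.isUnit_det, one_mulVec]
  have hne : M⁻¹ *ᵥ y ≠ 0 := fun h ↦ hy <| by rw [← hMy, h, mulVec_zero]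
  have hlt := hP.1.quadForm_closedLoop_lt hH hne
  rw [← hM, hMy] at hlt
  simpa only [quadForm_neg_left, neg_lt_neg_iff] using hlt

lemma inputWeight_posDef (hP : p.IsAntistabilizingSolution P) (hH : p.H.PosDef) :
    (p.inputWeight P).PosDef := by
  refine posDef_of_quadForm_pos (p.inputWeight_isSymm hP.1.symm) fun v hv ↦ ?_
  set M := p.A - p.B * p.gain P with hM
  -- The state from which the input `v - K x` leads to the origin in one step.
  set x := -(M⁻¹ *ᵥ (p.B *ᵥ v)) with hx
  have hstep : p.A *ᵥ x + p.B *ᵥ (v - p.gain P *ᵥ x) = 0 := by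
    have hMx : M *ᵥ x = -(p.B *ᵥ v) := by
      rw [hx, mulVec_neg, mulVec_mulVec, mul_nonsing_inv _ hP.2.isUnit_det, one_mulVec]
    rw [sub_eq_neg_add, mulVec_add, ← add_assoc, mulVec_add_mulVec_neg, ← hM, hMx,
      neg_add_cancel]
  have hcost := p.stageCost_add_quadForm hP.1.symm hP.1.isUnit x (v - p.gain P *ᵥ x)
  rw [hstep, quadForm_zero, add_zero, hP.1.riccati_eq, sub_add_cancel] at hcost
  have hxP : 0 ≤ quadForm (-P) x := quadForm_nonneg (hP.neg_posDef hH).posSemidef x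
  have hpos : 0 < p.stageCost x (v - p.gain P *ᵥ x) := by
    refine quadForm_pos hH fun h ↦ hv ?_
    have hx0 : x = 0 := funext fun i ↦ congrFun h (Sum.inl i)
    have hu0 : v - p.gain P *ᵥ x = 0 := funext fun i ↦ congrFun h (Sum.inr i)
    rwa [hx0, mulVec_zero, sub_zero] at hu0
  rw [quadForm_neg_left] at hxP
  linarith

lemma exists_sum_stageCost_le (hP : p.IsAntistabilizingSolution P) (hH : p.H.PosDef)
    {E : Matrix (Fin n) (Fin n) ℝ} (hE : E.PosDef) :
    ∃ C, 0 ≤ C ∧ ∀ x₀ u N, ∑ k ∈ Finset.range N, p.stageCost (p.state x₀ u k) (u k)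
      ≤ p.horizonCost (P + E) x₀ u N + C * (p.horizonCost (P + E) x₀ u N - quadForm P x₀) := by
  obtain ⟨C, hC, hCE⟩ := exists_quadForm_le_mul (-P) hE
  refine ⟨C, hC, fun x₀ u N ↦ ?_⟩
  have hlower := hP.1.quadForm_le_horizonCost (hP.inputWeight_posDef hH) x₀ u N
  have hadd := p.horizonCost_add P E x₀ u N
  have hbound : quadForm E (p.state x₀ u N)
      ≤ p.horizonCost (P + E) x₀ u N - quadForm P x₀ := by linarith
  calc ∑ k ∈ Finset.range N, p.stageCost (p.state x₀ u k) (u k)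
      = p.horizonCost P x₀ u N + quadForm (-P) (p.state x₀ u N) := by
        rw [quadForm_neg_left, horizonCost, quadForm, add_neg_cancel_right]
    _ ≤ p.horizonCost (P + E) x₀ u N + C * quadForm E (p.state x₀ u N) := by
        rw [hadd]
        exact add_le_add (le_add_of_nonneg_right (quadForm_nonneg hE.posSemidef _)) (hCE _)
    _ ≤ _ := by gcongr

lemma forcesConvergence_add (hP : p.IsAntistabilizingSolution P) (hH : p.H.PosDef)
    {E : Matrix (Fin n) (Fin n) ℝ} (hE : E.PosDef) : p.ForcesConvergence (P + E) := by
  intro x₀ u hcost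
  simp only [tendsto_atTop, not_forall, not_eventually, not_le] at hcost
  obtain ⟨b, hb⟩ := hcost
  obtain ⟨C, hC, hsum⟩ := hP.exists_sum_stageCost_le hH hE
  have hnonneg (k : ℕ) := stageCost_nonneg hH (p.state x₀ u k) (u k)
  refine tendsto_state_zero_of_summable hH <|
    summable_of_sum_range_le (c := b + C * (b - quadForm P x₀)) hnonneg fun N ↦ ?_
  obtain ⟨N', hNN', hN'⟩ := frequently_atTop.1 hb N
  calc ∑ k ∈ Finset.range N, p.stageCost (p.state x₀ u k) (u k)
      ≤ ∑ k ∈ Finset.range N', p.stageCost (p.state x₀ u k) (u k) :=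
        Finset.sum_le_sum_of_subset_of_nonneg (Finset.range_mono hNN') fun k _ _ ↦ hnonneg k
    _ ≤ _ := hsum x₀ u N'
    _ ≤ b + C * (b - quadForm P x₀) := by gcongr

end IsAntistabilizingSolution

end PosDefCost

section Rotation

variable (p : LQProblem n m) {L P : Matrix (Fin n) (Fin n) ℝ} (hL : L.IsSymm)

/-- The problem with the stage cost `ℓ(x,u) + λ(x) - λ(A x + B u)` rotated by the storage function
`λ(x) = xᵀ L x`. -/
def rotate (L : Matrix (Fin n) (Fin n) ℝ) (hL : L.IsSymm) : LQProblem n m where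
  A := p.A
  B := p.B
  Q := p.Q + L - p.Aᵀ * L * p.A
  S := p.S - p.Bᵀ * L * p.A
  R := p.R - p.Bᵀ * L * p.B
  Q_symm := by
    simp only [IsSymm, transpose_sub, transpose_add, transpose_mul, transpose_transpose, hL.eq,
      p.Q_symm.eq, Matrix.mul_assoc]
  R_symm := by
    simp only [IsSymm, transpose_sub, transpose_mul, transpose_transpose, hL.eq,
      p.R_symm.eq, Matrix.mul_assoc]

lemma H_rotate : (p.rotate L hL).H = p.rotatedH L := by
  simp only [H, rotate, rotatedH, transpose_sub, transpose_mul, transpose_transpose, hL.eq,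
    Matrix.mul_assoc]

lemma inputWeight_rotate : (p.rotate L hL).inputWeight (P + L) = p.inputWeight P := by
  simp only [inputWeight, rotate, Matrix.mul_add, Matrix.add_mul]
  abel

lemma gain_rotate : (p.rotate L hL).gain (P + L) = p.gain P := by
  have hcross : p.S - p.Bᵀ * L * p.A + p.Bᵀ * (P + L) * p.A = p.S + p.Bᵀ * P * p.A := by
    simp only [Matrix.mul_add, Matrix.add_mul]
    abel
  have hW := p.inputWeight_rotate (P := P) hL
  simp only [inputWeight] at hW
  rw [gain, hW, gain]
  exact congrArg _ hcross

lemma riccati_rotate : (p.rotate L hL).riccati (P + L) = p.riccati P + L := by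
  rw [riccati, gain_rotate, riccati]
  simp only [rotate, transpose_sub, transpose_mul, transpose_transpose, hL.eq,
    Matrix.mul_add, Matrix.add_mul, Matrix.sub_mul, Matrix.mul_assoc]
  abel

lemma isDARESolution_rotate_iff :
    (p.rotate L hL).IsDARESolution (P + L) ↔ p.IsDARESolution P := by
  have hsymm : (P + L).IsSymm ↔ P.IsSymm :=
    ⟨fun h ↦ by simpa only [add_sub_cancel_right] using h.sub hL, fun h ↦ h.add hL⟩
  rw [isDARESolution_iff, isDARESolution_iff, inputWeight_rotate, riccati_rotate, add_left_inj,
    hsymm]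

lemma isStabilizingSolution_rotate_iff :
    (p.rotate L hL).IsStabilizingSolution (P + L) ↔ p.IsStabilizingSolution P := by
  rw [IsStabilizingSolution, isDARESolution_rotate_iff, gain_rotate]
  rfl

lemma isAntistabilizingSolution_rotate_iff :
    (p.rotate L hL).IsAntistabilizingSolution (P + L) ↔ p.IsAntistabilizingSolution P := by
  rw [IsAntistabilizingSolution, isDARESolution_rotate_iff, gain_rotate]
  rfl

lemma stageCost_rotate (x : Fin n → ℝ) (u : Fin m → ℝ) :
    (p.rotate L hL).stageCost x u
      = p.stageCost x u + (quadForm L x - quadForm L (p.A *ᵥ x + p.B *ᵥ u)) := by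
  have hmatrix : (p.rotate L hL).lookaheadH L = p.H + fromBlocks L 0 0 0 := by
    rw [lookaheadH_eq_fromBlocks _ hL, H, fromBlocks_add]
    simp only [rotate, inputWeight, sub_add_cancel, add_zero]
  have hL_x : quadForm (fromBlocks L 0 0 0) (Sum.elim x u) = quadForm L x := by
    simp [quadForm, fromBlocks_mulVec]
  have hform := quadForm_lookaheadH (p.rotate L hL) L x u
  rw [hmatrix, quadForm_add_left, hL_x] at hform
  rw [← add_sub_assoc]
  exact (sub_eq_of_eq_add hform).symm

lemma state_rotate (x₀ : Fin n → ℝ) (u : ℕ → Fin m → ℝ) :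
    (p.rotate L hL).state x₀ u = p.state x₀ u := by
  funext k
  induction k with
  | zero => rfl
  | succ k ih => rw [state, state, ih]; rfl

lemma horizonCost_rotate (Pf : Matrix (Fin n) (Fin n) ℝ) (x₀ : Fin n → ℝ) (u : ℕ → Fin m → ℝ)
    (N : ℕ) :
    (p.rotate L hL).horizonCost (Pf + L) x₀ u N = p.horizonCost Pf x₀ u N + quadForm L x₀ := by
  have htelescope := Finset.sum_range_sub' (fun k ↦ quadForm L (p.state x₀ u k)) N
  have hsum : ∑ k ∈ Finset.range N, (p.rotate L hL).stageCost (p.state x₀ u k) (u k)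
      = ∑ k ∈ Finset.range N, p.stageCost (p.state x₀ u k) (u k)
        + (quadForm L x₀ - quadForm L (p.state x₀ u N)) := by
    simp only [stageCost_rotate, Finset.sum_add_distrib]
    exact congrArg _ htelescope
  rw [horizonCost_add, horizonCost, horizonCost, state_rotate, hsum]
  ring

variable {p hL} in
lemma ForcesConvergence.of_rotate {Pf : Matrix (Fin n) (Fin n) ℝ}
    (h : (p.rotate L hL).ForcesConvergence (Pf + L)) : p.ForcesConvergence Pf := by
  intro x₀ u hcost
  rw [← p.state_rotate hL]
  refine h x₀ u fun htop ↦ hcost ?_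
  simpa only [horizonCost_rotate, add_neg_cancel_right]
    using tendsto_atTop_add_const_right atTop (-quadForm L x₀) htop

end Rotation

namespace IsStrictlyPreDissipative

variable {p : LQProblem n m} {P : Matrix (Fin n) (Fin n) ℝ}

lemma exists_isStabilizingSolution (hdiss : p.IsStrictlyPreDissipative)
    (hstab : p.IsStabilizable) : ∃ P, p.IsStabilizingSolution P := by
  obtain ⟨L, hL, hH⟩ := hdiss
  rw [← p.H_rotate hL] at hH
  obtain ⟨P, hP⟩ := exists_isStabilizingSolution_of_posDef hH hstab
  exact ⟨P - L, (p.isStabilizingSolution_rotate_iff hL).1 (by rwa [sub_add_cancel])⟩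

lemma inputWeight_posDef (hdiss : p.IsStrictlyPreDissipative) (hP : p.IsStabilizingSolution P) :
    (p.inputWeight P).PosDef := by
  obtain ⟨L, hL, hH⟩ := hdiss
  rw [← p.H_rotate hL] at hH
  rw [← p.isStabilizingSolution_rotate_iff hL] at hP
  have hPL : (P + L).PosDef := (hP.1.isStabilizingSolution_iff_posDef hH).1 hP
  rw [← p.inputWeight_rotate hL]
  exact LQProblem.inputWeight_posDef hH hPL.posSemidef

lemma forcesConvergence_add (hdiss : p.IsStrictlyPreDissipative)
    (hP : p.IsAntistabilizingSolution P) {E : Matrix (Fin n) (Fin n) ℝ} (hE : E.PosDef) :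
    p.ForcesConvergence (P + E) := by
  obtain ⟨L, hL, hH⟩ := hdiss
  rw [← p.H_rotate hL] at hH
  refine ForcesConvergence.of_rotate (hL := hL) ?_
  rw [add_right_comm]
  exact ((p.isAntistabilizingSolution_rotate_iff hL).2 hP).forcesConvergence_add hH hE

end IsStrictlyPreDissipative

namespace IsStabilizingSolution

variable {p : LQProblem n m} {P Pf : Matrix (Fin n) (Fin n) ℝ}

lemma tendsto_horizonCost (hP : p.IsStabilizingSolution P) (Pf : Matrix (Fin n) (Fin n) ℝ)
    (x₀ : Fin n → ℝ) :
    Tendsto (p.horizonCost Pf x₀ (p.feedbackInput (p.gain P) x₀)) atTop (𝓝 (quadForm P x₀)) := by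
  have hcost (N : ℕ) : p.horizonCost Pf x₀ (p.feedbackInput (p.gain P) x₀) N
      = quadForm P x₀ + quadForm (Pf - P) ((p.A - p.B * p.gain P) ^ N *ᵥ x₀) := by
    rw [← add_sub_cancel P Pf, horizonCost_add, hP.1.horizonCost_eq]
    simp [state_feedbackInput, feedbackInput]
  rw [funext hcost]
  simpa only [add_zero] using
    (tendsto_quadForm_zero (Pf - P) (hP.2.tendsto_pow_mulVec x₀)).const_add (quadForm P x₀)

lemma hasCost_feedbackInput (hP : p.IsStabilizingSolution P) (Pf : Matrix (Fin n) (Fin n) ℝ)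
    (x₀ : Fin n → ℝ) : p.HasCost Pf x₀ (p.feedbackInput (p.gain P) x₀) (quadForm P x₀) :=
  EReal.tendsto_coe.2 (hP.tendsto_horizonCost Pf x₀)

lemma unique {P' : Matrix (Fin n) (Fin n) ℝ} (hP : p.IsStabilizingSolution P)
    (hP' : p.IsStabilizingSolution P') (hW : (p.inputWeight P).PosDef)
    (hW' : (p.inputWeight P').PosDef) : P = P' := by
  refine eq_of_quadForm_eq hP.1.symm hP'.1.symm (funext fun x ↦ le_antisymm ?_ ?_)
  · exact ge_of_tendsto' (hP'.tendsto_horizonCost P x) (hP.1.quadForm_le_horizonCost hW x _)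
  · exact ge_of_tendsto' (hP.tendsto_horizonCost P' x) (hP'.1.quadForm_le_horizonCost hW' x _)

lemma quadForm_le_liminf (hP : p.IsStabilizingSolution P) (hW : (p.inputWeight P).PosDef)
    (hPf : p.ForcesConvergence Pf) (x₀ : Fin n → ℝ) (u : ℕ → Fin m → ℝ) :
    (quadForm P x₀ : EReal)
      ≤ liminf (fun N : ℕ ↦ (p.horizonCost Pf x₀ u N : EReal)) atTop := by
  by_cases htop : Tendsto (p.horizonCost Pf x₀ u) atTop atTop
  · rw [(EReal.tendsto_coe_nhds_top_iff.2 htop).liminf_eq]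
    exact le_top
  · have hterminal : Tendsto
        (fun N ↦ ((quadForm P x₀ + quadForm (Pf - P) (p.state x₀ u N) : ℝ) : EReal))
        atTop (𝓝 (quadForm P x₀)) := EReal.tendsto_coe.2 <| by
      simpa only [add_zero] using
        (tendsto_quadForm_zero (Pf - P) (hPf x₀ u htop)).const_add (quadForm P x₀)
    rw [← hterminal.liminf_eq]
    refine liminf_le_liminf (.of_forall fun N ↦ EReal.coe_le_coe_iff.2 ?_)
    rw [← add_sub_cancel P Pf, horizonCost_add, add_sub_cancel]
    gcongr
    exact hP.1.quadForm_le_horizonCost hW x₀ u N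

lemma isOptimalValue (hP : p.IsStabilizingSolution P) (hW : (p.inputWeight P).PosDef)
    (hPf : p.ForcesConvergence Pf) (x₀ : Fin n → ℝ) :
    p.IsOptimalValue Pf x₀ (quadForm P x₀) := by
  refine ⟨⟨_, hP.hasCost_feedbackInput Pf x₀⟩, ?_⟩
  rintro c ⟨u, hu⟩
  rw [← Tendsto.liminf_eq hu]
  exact hP.quadForm_le_liminf hW hPf x₀ u

lemma tendsto_sum_quadForm_inputWeight (hP : p.IsStabilizingSolution P)
    (hPf : p.ForcesConvergence Pf) {x₀ : Fin n → ℝ} {u : ℕ → Fin m → ℝ}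
    (hu : p.HasCost Pf x₀ u (quadForm P x₀)) :
    Tendsto (fun N ↦ ∑ k ∈ Finset.range N,
      quadForm (p.inputWeight P) (u k + p.gain P *ᵥ p.state x₀ u k)) atTop (𝓝 0) := by
  have hcost : Tendsto (p.horizonCost Pf x₀ u) atTop (𝓝 (quadForm P x₀)) :=
    EReal.tendsto_coe.1 hu
  have hstate := hPf x₀ u (not_tendsto_atTop_of_tendsto_nhds hcost)
  have hdiff := (hcost.sub (tendsto_quadForm_zero (Pf - P) hstate)).sub_const (quadForm P x₀)
  rw [sub_zero, sub_self] at hdiff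
  refine hdiff.congr fun N ↦ ?_
  rw [← add_sub_cancel P Pf, horizonCost_add, add_sub_cancel, add_sub_cancel_right,
    hP.1.horizonCost_eq, add_sub_cancel_left]

lemma isOptimalInput_iff (hP : p.IsStabilizingSolution P) (hW : (p.inputWeight P).PosDef)
    (hPf : p.ForcesConvergence Pf) (x₀ : Fin n → ℝ) (u : ℕ → Fin m → ℝ) :
    p.IsOptimalInput Pf x₀ u ↔ ∀ k, u k = -(p.gain P *ᵥ p.state x₀ u k) := by
  have hopt := hP.isOptimalValue hW hPf x₀
  constructor
  · rintro ⟨c, hc, hcopt⟩ k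
    obtain rfl := hcopt.unique hopt
    have hnonneg (j : ℕ) := quadForm_nonneg hW.posSemidef (u j + p.gain P *ᵥ p.state x₀ u j)
    have hzero := hasSum_zero_iff_of_nonneg hnonneg |>.1 <|
      (hasSum_iff_tendsto_nat_of_nonneg hnonneg 0).2
        (hP.tendsto_sum_quadForm_inputWeight hPf hc)
    by_contra hne
    exact (quadForm_pos hW fun h ↦ hne (eq_neg_of_add_eq_zero_left h)).ne' (congrFun hzero k)
  · intro hu
    obtain rfl := eq_feedbackInput_iff.2 hu
    exact ⟨_, hP.hasCost_feedbackInput Pf x₀, hopt⟩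

end IsStabilizingSolution

end LQProblem

end

theorem mainTheorem3 {n m : ℕ} (p : LQProblem n m)
    (hstab : p.IsStabilizable)
    (hdiss : p.IsStrictlyPreDissipative)
    (Pa : Matrix (Fin n) (Fin n) ℝ) (hPa : p.IsAntistabilizingSolution Pa)
    (E : Matrix (Fin n) (Fin n) ℝ) (hE : E.PosDef) :
    ∃ Ps : Matrix (Fin n) (Fin n) ℝ,
      p.IsStabilizingSolution Ps ∧
      (∀ P : Matrix (Fin n) (Fin n) ℝ, p.IsStabilizingSolution P → P = Ps) ∧
      (∀ x₀ : Fin n → ℝ,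
        p.IsOptimalValue (Pa + E) x₀ ((x₀ ⬝ᵥ (Ps *ᵥ x₀) : ℝ) : EReal) ∧
        (∀ u : ℕ → Fin m → ℝ,
          p.IsOptimalInput (Pa + E) x₀ u ↔ ∀ k : ℕ, u k = -(p.gain Ps *ᵥ p.state x₀ u k)) ∧
        (∀ u : ℕ → Fin m → ℝ,
          ((x₀ ⬝ᵥ (Ps *ᵥ x₀) : ℝ) : EReal) ≤
            liminf (fun N : ℕ => (p.horizonCost (Pa + E) x₀ u N : EReal)) atTop)) ∧
      IsAsymptoticallyStableEquilibrium
        (fun x : Fin n → ℝ => p.A *ᵥ x + p.B *ᵥ (-(p.gain Ps *ᵥ x))) 0 := by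
  obtain ⟨Ps, hPs⟩ := hdiss.exists_isStabilizingSolution hstab
  have hW := hdiss.inputWeight_posDef hPs
  have hconv := hdiss.forcesConvergence_add hPa hE
  refine ⟨Ps, hPs, fun P hP ↦ hP.unique hPs (hdiss.inputWeight_posDef hP) hW, fun x₀ ↦
    ⟨hPs.isOptimalValue hW hconv x₀, hPs.isOptimalInput_iff hW hconv x₀,
      hPs.quadForm_le_liminf hW hconv x₀⟩, ?_⟩
  simpa only [p.mulVec_add_mulVec_neg] using hPs.2.isAsymptoticallyStableEquilibrium
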